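/- Let $a<b$, let $n\ge 1$ be an integer, $h=(b-a)/n$, $I=[a,b]$. Put $x_i=a+ih$ for $0\le i\le n$, and $x_i=a$ for $i<0$, $x_i=b$ for $i>n$ (multiple knots at the endpoints). For $d\in\{2,3\}$ let $B_j$, $1\le j\le n+d$, be the normalized B-splines of degree $d$ on $I$ with knots $x_{j-d-1},\dots,x_j$ (Cox--de Boor recursion). Put $t_j=\frac12(x_{j-2}+x_{j-1})$, $1\le j\le n+2$, and let $f$ be any real function on $I$. Quadratic quasi-interpolant: with $f_j=f(t_j)$, $Q_2f=\sum_{j=1}^{n+2}\mu_j(f)B_j$, where $\mu_1(f)=f_1$, $\mu_2(f)=\frac16(-2f_1+9f_2-f_3)$, $\mu_j(f)=\frac18(-f_{j-1}+10f_j-f_{j+1})$ for $3\le j\le n$, $\mu_{n+1}(f)=\frac16(-f_n+9f_{n+1}-2f_{n+2})$, $\mu_{n+2}(f)=f_{n+2}$. Cubic quasi-interpolant: with $f_j=f(x_j)$, $Q_3f=\sum_{j=1}^{n+3}\mu_j(f)B_j$, where $\mu_1(f)=f_0$, $\mu_2(f)=\frac1{18}(7f_0+18f_1-9f_2+2f_3)$,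 $\mu_j(f)=\frac16(-f_{j-3}+8f_{j-2}-f_{j-1})$ for $3\le j\le n+1$, $\mu_{n+2}(f)=\frac1{18}(2f_{n-3}-9f_{n-2}+18f_{n-1}+7f_n)$, $\mu_{n+3}(f)=f_n$. (i) Let $n\ge 4$ and let $y=(f(t_1),\dots,f(t_{n+2}))^T$. Then $Q_2f$ is differentiable on $I$ at every $t_j$ (one-sidedly at $t_1=a$ and $t_{n+2}=b$), and the vector $y'=((Q_2f)'(t_1),\dots,(Q_2f)'(t_{n+2}))^T$ is $y'=\mathcal D_2y$. Here $h\mathcal D_2\in\mathbb R^{(n+2)\times(n+2)}$ has the following rows, all entries not listed being zero: row $1$: $(-\frac83,\,3,\,-\frac13)$ in columns $1$ to $3$; row $2$: $(-\frac76,\,\frac{11}{16},\,\frac{13}{24},\,-\frac1{16})$ in columns $1$ to $4$; row $3$: $(\frac16,\,-\frac34,\,\frac1{48},\,\frac58,\,-\frac1{16})$ in columns $1$ to $5$; row $j$, $4\le j\le n-1$: $(\frac1{16},\,-\frac58,\,0,\,\frac58,\,-\frac1{16})$ in columns $j-2$ to $j+2$; row $n$: $(\frac1{16},\,-\frac58,\,-\frac1{48},\,\frac34,\,-\frac16)$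 in columns $n-2$ to $n+2$; row $n+1$: $(\frac1{16},\,-\frac{13}{24},\,-\frac{11}{16},\,\frac76)$ in columns $n-1$ to $n+2$; row $n+2$: $(\frac13,\,-3,\,\frac83)$ in columns $n$ to $n+2$. In particular, $(\mathcal D_2)_{ik}=0$ if $|i-k|>2$, and for $4\le j\le n-1$ $$(Q_2f)'(t_j)=\frac1h\Bigl(\tfrac1{16}f(t_{j-2})-\tfrac58f(t_{j-1})+\tfrac58f(t_{j+1})-\tfrac1{16}f(t_{j+2})\Bigr).$$ (ii) Let $n\ge 3$ and let $y=(f(x_0),\dots,f(x_n))^T$. Then $Q_3f$ is differentiable on $I$ at every $x_j$, $0\le j\le n$ (one-sidedly at $x_0=a$ and $x_n=b$), and the vector $y'=((Q_3f)'(x_0),\dots,(Q_3f)'(x_n))^T$ is $y'=\mathcal D_3y$. Here $h\mathcal D_3\in\mathbb R^{(n+1)\times(n+1)}$ has the following rows (rows and columns numbered from $0$ to $n$), all entries not listed being zero: row $0$: $(-\frac{11}6,\,3,\,-\frac32,\,\frac13)$ in columns $0$ to $3$; row $1$: $(-\frac13,\,-\frac12,\,1,\,-\frac16)$ in columns $0$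 to $3$; row $j$, $2\le j\le n-2$: $(\frac1{12},\,-\frac23,\,0,\,\frac23,\,-\frac1{12})$ in columns $j-2$ to $j+2$; row $n-1$: $(\frac16,\,-1,\,\frac12,\,\frac13)$ in columns $n-3$ to $n$; row $n$: $(-\frac13,\,\frac32,\,-3,\,\frac{11}6)$ in columns $n-3$ to $n$. In particular, $(\mathcal D_3)_{ik}=0$ if $|i-k|>3$, and for $2\le j\le n-2$ $$(Q_3f)'(x_j)=\frac1h\Bigl(\tfrac1{12}f(x_{j-2})-\tfrac23f(x_{j-1})+\tfrac23f(x_{j+1})-\tfrac1{12}f(x_{j+2})\Bigr).$$ -/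

import Mathlib

noncomputable section

namespace SplineQI

/-- The mesh length `h = (b - a) / n` of the uniform partition of `[a, b]` in `n` subintervals. -/
def mesh (a b : ℝ) (n : ℕ) : ℝ := (b - a) / n

/-- The knots: `x_i = a + i h` for `0 ≤ i ≤ n`, with multiple knots at the endpoints, that is,
`x_i = a` for `i ≤ 0` and `x_i = b` for `n ≤ i`. -/
def knot (a b : ℝ) (n : ℕ) (i : ℤ) : ℝ :=
  if i ≤ 0 then a else if (n : ℤ) ≤ i then b else a + i * mesh a b n

/-- The points `t_j = (x_{j-2} + x_{j-1}) / 2`. -/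
def tPoint (a b : ℝ) (n : ℕ) (j : ℤ) : ℝ :=
  (knot a b n (j - 2) + knot a b n (j - 1)) / 2

/-- The normalized B-spline `B_j` of degree `d`, with knots `x_{j-d-1}, …, x_j`, by the
Cox-de Boor recursion (a quotient with zero denominator counts as zero). In degree `0` it is the
indicator function of `[x_{j-1}, x_j)`; the last interval `[x_{n-1}, x_n]` is closed at `x_n = b`,
so that the B-splines are the usual functions on the whole of `[a, b]`. -/
def bspline (a b : ℝ) (n : ℕ) : ℕ → ℤ → ℝ → ℝ
  | 0, j, x =>
      open Classical in
      if (knot a b n (j - 1) ≤ x ∧ x < knot a b n j) ∨ (j = n ∧ x = b) then 1 else 0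
  | d + 1, j, x =>
      (x - knot a b n (j - d - 2)) / (knot a b n (j - 1) - knot a b n (j - d - 2))
          * bspline a b n d (j - 1) x
        + (knot a b n j - x) / (knot a b n j - knot a b n (j - d - 1))
          * bspline a b n d j x

/-- The coefficient functionals `μ_j` of the quadratic quasi-interpolant, on the values
`f_j = f (t_j)`. -/
def mu2 (a b : ℝ) (n : ℕ) (f : ℝ → ℝ) (j : ℤ) : ℝ :=
  let F : ℤ → ℝ := fun i => f (tPoint a b n i)
  if j = 1 then F 1
  else if j = 2 then 1 / 6 * (-2 * F 1 + 9 * F 2 - F 3)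
  else if j = n + 1 then 1 / 6 * (-F n + 9 * F (n + 1) - 2 * F (n + 2))
  else if j = n + 2 then F (n + 2)
  else 1 / 8 * (-F (j - 1) + 10 * F j - F (j + 1))

/-- The quadratic discrete quasi-interpolant `Q_2 f = ∑_{j = 1}^{n + 2} μ_j(f) B_j`. -/
def Q2 (a b : ℝ) (n : ℕ) (f : ℝ → ℝ) (x : ℝ) : ℝ :=
  ∑ j ∈ Finset.Icc (1 : ℤ) (n + 2), mu2 a b n f j * bspline a b n 2 j x

/-- The coefficient functionals `μ_j` of the cubic quasi-interpolant, on the values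
`f_j = f (x_j)`. -/
def mu3 (a b : ℝ) (n : ℕ) (f : ℝ → ℝ) (j : ℤ) : ℝ :=
  let F : ℤ → ℝ := fun i => f (knot a b n i)
  if j = 1 then F 0
  else if j = 2 then 1 / 18 * (7 * F 0 + 18 * F 1 - 9 * F 2 + 2 * F 3)
  else if j = n + 2 then
    1 / 18 * (2 * F (n - 3) - 9 * F (n - 2) + 18 * F (n - 1) + 7 * F n)
  else if j = n + 3 then F n
  else 1 / 6 * (-F (j - 3) + 8 * F (j - 2) - F (j - 1))

/-- The cubic discrete quasi-interpolant `Q_3 f = ∑_{j = 1}^{n + 3} μ_j(f) B_j`. -/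
def Q3 (a b : ℝ) (n : ℕ) (f : ℝ → ℝ) (x : ℝ) : ℝ :=
  ∑ j ∈ Finset.Icc (1 : ℤ) (n + 3), mu3 a b n f j * bspline a b n 3 j x

/-- The entry in column `k` of a row that holds the numbers in the list `c` in the columns
`s, s + 1, …` and zeros elsewhere. -/
def rowFrom (s : ℤ) (c : List ℝ) (k : ℤ) : ℝ :=
  if s ≤ k then c.getD (k - s).toNat 0 else 0

/-- The entry of `h 𝓓₂` in row `i` and column `k`, for `1 ≤ i, k ≤ n + 2`. -/
def D2entry (n : ℕ) (i k : ℤ) : ℝ :=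
  if i = 1 then rowFrom 1 [-8 / 3, 3, -1 / 3] k
  else if i = 2 then rowFrom 1 [-7 / 6, 11 / 16, 13 / 24, -1 / 16] k
  else if i = 3 then rowFrom 1 [1 / 6, -3 / 4, 1 / 48, 5 / 8, -1 / 16] k
  else if i = n then rowFrom (n - 2) [1 / 16, -5 / 8, -1 / 48, 3 / 4, -1 / 6] k
  else if i = n + 1 then rowFrom (n - 1) [1 / 16, -13 / 24, -11 / 16, 7 / 6] k
  else if i = n + 2 then rowFrom n [1 / 3, -3, 8 / 3] k
  else rowFrom (i - 2) [1 / 16, -5 / 8, 0, 5 / 8, -1 / 16] k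

/-- The differentiation matrix `𝓓₂` of size `n + 2`; its rows and columns are numbered from `1`
in the formulas and from `0` in `Fin (n + 2)`. -/
def D2 (a b : ℝ) (n : ℕ) : Matrix (Fin (n + 2)) (Fin (n + 2)) ℝ :=
  Matrix.of fun i k => D2entry n ((i : ℕ) + 1) ((k : ℕ) + 1) / mesh a b n

/-- The entry of `h 𝓓₃` in row `i` and column `k`, for `0 ≤ i, k ≤ n`. -/
def D3entry (n : ℕ) (i k : ℤ) : ℝ :=
  if i = 0 then rowFrom 0 [-11 / 6, 3, -3 / 2, 1 / 3] k
  else if i = 1 then rowFrom 0 [-1 / 3, -1 / 2, 1, -1 / 6] k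
  else if i = n - 1 then rowFrom (n - 3) [1 / 6, -1, 1 / 2, 1 / 3] k
  else if i = n then rowFrom (n - 3) [-1 / 3, 3 / 2, -3, 11 / 6] k
  else rowFrom (i - 2) [1 / 12, -2 / 3, 0, 2 / 3, -1 / 12] k

/-- The differentiation matrix `𝓓₃` of size `n + 1`, rows and columns numbered from `0`. -/
def D3 (a b : ℝ) (n : ℕ) : Matrix (Fin (n + 1)) (Fin (n + 1)) ℝ :=
  Matrix.of fun i k => D3entry n (i : ℕ) (k : ℕ) / mesh a b n

end SplineQI

end

/-! On one cell `[x_{m-1}, x_m]` only `B_m, …, B_{m+d}` are non-zero, so a spline `∑ c_j B_j` is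
there an explicit polynomial in `c_m, …, c_{m+d}` (`sum_bspline_two`, `sum_bspline_three`). Every
denominator that survives is the length of a knot interval containing the cell, hence non-zero even
with multiple knots. Differentiating gives the classical rule: the derivative is a spline of degree
`d - 1` whose coefficients are `d (c_{j+1} - c_j)` divided by a knot difference
(`hasDerivAt_quadPoly`, `hasDerivAt_cubicPoly`).

In the quadratic case `t_2, …, t_{n+1}` are midpoints of cells, so one polynomial describes the
spline near each of them. In the cubic case the interior points are knots: the polynomials of the
two adjacent cells agree there in value and first derivative, and the one-sided derivatives glue
(`hasDerivAt_spline_three_knot`). At `a` and `b` only the two extreme coefficients enter.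

It remains to insert the functionals `μ_j`. Knot differences are integer multiples of `h`, shorter
near the ends because of the repeated knots, and each row of the matrices becomes a rational
identity. -/

namespace SplineQI

/-! ### Knots of the uniform partition -/

section Knots

variable {a b : ℝ} {n : ℕ}

lemma mesh_pos (hab : a < b) (hn : 1 ≤ n) : 0 < mesh a b n :=
  div_pos (sub_pos.2 hab) (by exact_mod_cast hn)

lemma add_mul_mesh (hn : 1 ≤ n) : a + n * mesh a b n = b := by
  have : (n : ℝ) ≠ 0 := by positivity
  unfold mesh
  field_simp
  ring

lemma knot_of_nonpos {i : ℤ} (hi : i ≤ 0) : knot a b n i = a := by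
  simp [knot, hi]

lemma knot_of_ge (hn : 1 ≤ n) {i : ℤ} (hi : (n : ℤ) ≤ i) : knot a b n i = b := by
  have : ¬ i ≤ 0 := by omega
  simp [knot, hi, this]

lemma knot_of_mem (hn : 1 ≤ n) {i : ℤ} (h0 : 0 ≤ i) (hi : i ≤ n) :
    knot a b n i = a + i * mesh a b n := by
  rcases h0.eq_or_lt with rfl | h0
  · simp [knot]
  rcases hi.eq_or_lt with rfl | hi
  · rw [knot_of_ge hn le_rfl]
    exact_mod_cast (add_mul_mesh hn).symm
  · simp [knot, not_le.2 h0, not_le.2 hi]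

/-- Clamping the index to `[0, n]` removes the case distinction, so that comparisons and differences
of knots reduce to integer arithmetic. -/
lemma knot_eq_clamp (hn : 1 ≤ n) (i : ℤ) :
    knot a b n i = a + ((max 0 (min i n) : ℤ) : ℝ) * mesh a b n := by
  rw [← knot_of_mem hn (by omega) (by omega)]
  rcases le_total i 0 with h | h
  · rw [knot_of_nonpos h, knot_of_nonpos (by omega)]
  rcases le_total i n with h' | h'
  · congr 1
    omega
  · rw [knot_of_ge hn h', knot_of_ge hn (by omega)]

lemma knot_mono (hab : a < b) (hn : 1 ≤ n) : Monotone (knot a b n) := by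
  intro i j hij
  rw [knot_eq_clamp hn, knot_eq_clamp hn]
  have := mesh_pos hab hn
  have h : max 0 (min i (n : ℤ)) ≤ max 0 (min j (n : ℤ)) := by omega
  gcongr

lemma knot_lt_knot (hab : a < b) (hn : 1 ≤ n) {i j : ℤ} (hij : i < j) (hj : 0 < j)
    (hi : i < n) : knot a b n i < knot a b n j := by
  rw [knot_eq_clamp hn, knot_eq_clamp hn]
  have := mesh_pos hab hn
  have h : max 0 (min i (n : ℤ)) < max 0 (min j (n : ℤ)) := by omega
  gcongr

lemma knot_le_right (hab : a < b) (hn : 1 ≤ n) (i : ℤ) : knot a b n i ≤ b := by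
  calc knot a b n i ≤ knot a b n (max i n) := knot_mono hab hn (le_max_left _ _)
    _ = b := knot_of_ge hn (le_max_right i n)

end Knots

/-- The point `x` belongs to the `m`-th cell of the partition: `[x_{m-1}, x_m)` for `m < n` and
`[x_{n-1}, x_n]` for `m = n`. -/
structure InCell (a b : ℝ) (n : ℕ) (m : ℤ) (x : ℝ) : Prop where
  one_le : 1 ≤ m
  le_n : m ≤ n
  knot_le : knot a b n (m - 1) ≤ x
  lt_knot : x < knot a b n m ∨ (m = n ∧ x = b)

/-! ### B-splines of degree 0 and 1 on a cell -/

section Local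

variable {a b : ℝ} {n : ℕ} {m : ℤ} {x : ℝ}

lemma bspline_zero_self (hx : InCell a b n m x) : bspline a b n 0 m x = 1 := by
  rw [bspline, if_pos]
  rcases hx.lt_knot with h | h
  · exact Or.inl ⟨hx.knot_le, h⟩
  · exact Or.inr h

lemma bspline_zero_of_ne (hab : a < b) (hx : InCell a b n m x) {j : ℤ} (hj : j ≠ m) :
    bspline a b n 0 j x = 0 := by
  have hm := hx.one_le
  have hmn := hx.le_n
  have hn : 1 ≤ n := by omega
  rw [bspline, if_neg]
  rintro (⟨h1, h2⟩ | ⟨h1, h2⟩)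
  · rcases lt_or_gt_of_ne hj with h | h
    · exact absurd ((knot_mono hab hn (by omega : j ≤ m - 1)).trans hx.knot_le) (not_le.2 h2)
    · rcases hx.lt_knot with h3 | ⟨h3, h4⟩
      · exact absurd ((knot_mono hab hn (by omega : m ≤ j - 1)).trans h1) (not_le.2 h3)
      · rw [knot_of_ge hn (by omega)] at h2
        exact h2.ne h4
  · rcases hx.lt_knot with h3 | ⟨h3, h4⟩
    · exact absurd (knot_le_right hab hn m) (not_le.2 (h2 ▸ h3))
    · omega

/-- On the `m`-th cell only `B_m, …, B_{m+d}` are non-zero. -/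
lemma bspline_eq_zero (hab : a < b) (hx : InCell a b n m x) (d : ℕ) (j : ℤ)
    (hj : j < m ∨ m + d < j) : bspline a b n d j x = 0 := by
  induction d generalizing j with
  | zero => exact bspline_zero_of_ne hab hx (by push_cast at hj; omega)
  | succ d ih =>
    push_cast at hj
    -- Outside `m, …, m + d + 1`, both `j - 1` and `j` are outside `m, …, m + d`.
    rw [bspline, ih (j - 1) (by omega), ih j (by omega)]
    simp

lemma bspline_one_left (hab : a < b) (hx : InCell a b n m x) :
    bspline a b n 1 m x = (knot a b n m - x) / (knot a b n m - knot a b n (m - 1)) := by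
  rw [bspline, bspline_zero_self hx, bspline_zero_of_ne hab hx (by omega)]
  simp

lemma bspline_one_right (hab : a < b) (hx : InCell a b n m x) :
    bspline a b n 1 (m + 1) x
      = (x - knot a b n (m - 1)) / (knot a b n m - knot a b n (m - 1)) := by
  rw [bspline, bspline_zero_of_ne hab hx (j := m + 1) (by omega), add_sub_cancel_right,
    bspline_zero_self hx, show m + 1 - ((0 : ℕ) : ℤ) - 2 = m - 1 by push_cast; ring]
  simp

end Local

/-- The restriction of the first quadratic B-spline of the cell `[p₁, p₂]`. -/
noncomputable def quadPiece₀ (p₀ p₁ p₂ x : ℝ) : ℝ := (p₂ - x) / (p₂ - p₀) * ((p₂ - x) / (p₂ - p₁))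

/-- The restriction of the middle quadratic B-spline of the cell `[p₁, p₂]`. -/
noncomputable def quadPiece₁ (p₀ p₁ p₂ p₃ x : ℝ) : ℝ :=
  (x - p₀) / (p₂ - p₀) * ((p₂ - x) / (p₂ - p₁)) + (p₃ - x) / (p₃ - p₁) * ((x - p₁) / (p₂ - p₁))

/-- The restriction of the last quadratic B-spline of the cell `[p₁, p₂]`. -/
noncomputable def quadPiece₂ (p₁ p₂ p₃ x : ℝ) : ℝ := (x - p₁) / (p₃ - p₁) * ((x - p₁) / (p₂ - p₁))

/-- The quadratic spline with local coefficients `c₀, c₁, c₂` on the cell `[p₁, p₂]`. -/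
noncomputable def quadPoly (p₀ p₁ p₂ p₃ c₀ c₁ c₂ x : ℝ) : ℝ :=
  c₀ * quadPiece₀ p₀ p₁ p₂ x + c₁ * quadPiece₁ p₀ p₁ p₂ p₃ x + c₂ * quadPiece₂ p₁ p₂ p₃ x

/-- The cubic spline with local coefficients `c₀, …, c₃` on the cell `[q₂, q₃]`. -/
noncomputable def cubicPoly (q₀ q₁ q₂ q₃ q₄ q₅ c₀ c₁ c₂ c₃ x : ℝ) : ℝ :=
  c₀ * ((q₃ - x) / (q₃ - q₀) * quadPiece₀ q₁ q₂ q₃ x)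
    + c₁ * ((x - q₀) / (q₃ - q₀) * quadPiece₀ q₁ q₂ q₃ x
        + (q₄ - x) / (q₄ - q₁) * quadPiece₁ q₁ q₂ q₃ q₄ x)
    + c₂ * ((x - q₁) / (q₄ - q₁) * quadPiece₁ q₁ q₂ q₃ q₄ x
        + (q₅ - x) / (q₅ - q₂) * quadPiece₂ q₂ q₃ q₄ x)
    + c₃ * ((x - q₂) / (q₅ - q₂) * quadPiece₂ q₂ q₃ q₄ x)

/-! ### Quadratic and cubic splines as one polynomial per cell -/

section Local

variable {a b : ℝ} {n : ℕ} {m : ℤ} {x : ℝ}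

lemma bspline_two_left (hab : a < b) (hx : InCell a b n m x) :
    bspline a b n 2 m x
      = quadPiece₀ (knot a b n (m - 2)) (knot a b n (m - 1)) (knot a b n m) x := by
  rw [bspline, bspline_one_left hab hx, bspline_eq_zero hab hx 1 (m - 1) (by omega),
    show m - ((1 : ℕ) : ℤ) - 1 = m - 2 by push_cast; ring, quadPiece₀]
  ring

lemma bspline_two_mid (hab : a < b) (hx : InCell a b n m x) :
    bspline a b n 2 (m + 1) x
      = quadPiece₁ (knot a b n (m - 2)) (knot a b n (m - 1)) (knot a b n m)
          (knot a b n (m + 1)) x := by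
  rw [bspline, bspline_one_right hab hx, add_sub_cancel_right, bspline_one_left hab hx,
    show m + 1 - ((1 : ℕ) : ℤ) - 1 = m - 1 by push_cast; ring,
    show m + 1 - ((1 : ℕ) : ℤ) - 2 = m - 2 by push_cast; ring, quadPiece₁]

lemma bspline_two_right (hab : a < b) (hx : InCell a b n m x) :
    bspline a b n 2 (m + 2) x
      = quadPiece₂ (knot a b n (m - 1)) (knot a b n m) (knot a b n (m + 1)) x := by
  rw [bspline, bspline_eq_zero hab hx 1 (m + 2) (by push_cast; omega),
    show m + 2 - 1 = m + 1 by ring, bspline_one_right hab hx,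
    show m + 2 - ((1 : ℕ) : ℤ) - 2 = m - 1 by push_cast; ring, quadPiece₂]
  ring

lemma sum_bspline_two (hab : a < b) (hx : InCell a b n m x) (c : ℤ → ℝ) :
    ∑ j ∈ Finset.Icc (1 : ℤ) (n + 2), c j * bspline a b n 2 j x
      = quadPoly (knot a b n (m - 2)) (knot a b n (m - 1)) (knot a b n m) (knot a b n (m + 1))
          (c m) (c (m + 1)) (c (m + 2)) x := by
  have hm := hx.one_le
  have hmn := hx.le_n
  have hsub : ({m, m + 1, m + 2} : Finset ℤ) ⊆ Finset.Icc (1 : ℤ) (n + 2) := by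
    intro j
    simp only [Finset.mem_insert, Finset.mem_singleton, Finset.mem_Icc]
    omega
  rw [← Finset.sum_subset hsub, Finset.sum_insert (by simp), Finset.sum_insert (by simp),
    Finset.sum_singleton, bspline_two_left hab hx, bspline_two_mid hab hx,
    bspline_two_right hab hx, quadPoly]
  · ring
  · intro j _ hj
    simp only [Finset.mem_insert, Finset.mem_singleton] at hj
    rw [bspline_eq_zero hab hx 2 j (by push_cast; omega), mul_zero]

lemma bspline_three (j : ℤ) (x : ℝ) :
    bspline a b n 3 j x
      = (x - knot a b n (j - 4)) / (knot a b n (j - 1) - knot a b n (j - 4))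
          * bspline a b n 2 (j - 1) x
        + (knot a b n j - x) / (knot a b n j - knot a b n (j - 3)) * bspline a b n 2 j x := by
  rw [bspline, show j - ((2 : ℕ) : ℤ) - 2 = j - 4 by push_cast; ring,
    show j - ((2 : ℕ) : ℤ) - 1 = j - 3 by push_cast; ring]

lemma sum_bspline_three (hab : a < b) (hx : InCell a b n m x) (c : ℤ → ℝ) :
    ∑ j ∈ Finset.Icc (1 : ℤ) (n + 3), c j * bspline a b n 3 j x
      = cubicPoly (knot a b n (m - 3)) (knot a b n (m - 2)) (knot a b n (m - 1)) (knot a b n m)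
          (knot a b n (m + 1)) (knot a b n (m + 2))
          (c m) (c (m + 1)) (c (m + 2)) (c (m + 3)) x := by
  have hm := hx.one_le
  have hmn := hx.le_n
  have hsub : ({m, m + 1, m + 2, m + 3} : Finset ℤ) ⊆ Finset.Icc (1 : ℤ) (n + 3) := by
    intro j
    simp only [Finset.mem_insert, Finset.mem_singleton, Finset.mem_Icc]
    omega
  rw [← Finset.sum_subset hsub, Finset.sum_insert (by simp), Finset.sum_insert (by simp),
    Finset.sum_insert (by simp), Finset.sum_singleton]
  -- Of the quadratic B-splines in the recursion, those with indices `m - 1` and `m + 3` vanish on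
  -- the cell, so the two outer cubics keep a single term each.
  · simp only [bspline_three]
    simp only [show m + 1 - 4 = m - 3 by ring, show m + 2 - 4 = m - 2 by ring,
      show m + 3 - 4 = m - 1 by ring, show m + 1 - 3 = m - 2 by ring,
      show m + 2 - 3 = m - 1 by ring, show m + 3 - 3 = m by ring,
      show m + 1 - 1 = m by ring, show m + 2 - 1 = m + 1 by ring, show m + 3 - 1 = m + 2 by ring,
      bspline_two_left hab hx, bspline_two_mid hab hx, bspline_two_right hab hx,
      bspline_eq_zero hab hx 2 (m - 1) (by omega),
      bspline_eq_zero hab hx 2 (m + 3) (by push_cast; omega), cubicPoly]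
    ring
  · intro j _ hj
    simp only [Finset.mem_insert, Finset.mem_singleton] at hj
    rw [bspline_eq_zero hab hx 3 j (by push_cast; omega), mul_zero]

end Local

/-! ### Derivatives and end values of the local polynomials -/

section Derivatives

variable {p₀ p₁ p₂ p₃ : ℝ}

lemma hasDerivAt_sub_div (p q x : ℝ) : HasDerivAt (fun x => (x - p) / q) (1 / q) x :=
  ((hasDerivAt_id x).sub_const p).div_const q

lemma hasDerivAt_const_sub_div (p q x : ℝ) : HasDerivAt (fun x => (p - x) / q) (-1 / q) x :=
  ((hasDerivAt_id x).const_sub p).div_const q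

lemma hasDerivAt_quadPiece₀ (h02 : p₂ - p₀ ≠ 0) (h12 : p₂ - p₁ ≠ 0) (x : ℝ) :
    HasDerivAt (quadPiece₀ p₀ p₁ p₂) (-(2 / (p₂ - p₀) * ((p₂ - x) / (p₂ - p₁)))) x := by
  refine ((hasDerivAt_const_sub_div p₂ (p₂ - p₀) x).mul
    (hasDerivAt_const_sub_div p₂ (p₂ - p₁) x)).congr_deriv ?_
  field_simp
  ring

lemma hasDerivAt_quadPiece₁ (h02 : p₂ - p₀ ≠ 0) (h12 : p₂ - p₁ ≠ 0) (h13 : p₃ - p₁ ≠ 0)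
    (x : ℝ) :
    HasDerivAt (quadPiece₁ p₀ p₁ p₂ p₃)
      (2 / (p₂ - p₀) * ((p₂ - x) / (p₂ - p₁)) - 2 / (p₃ - p₁) * ((x - p₁) / (p₂ - p₁))) x := by
  refine (((hasDerivAt_sub_div p₀ (p₂ - p₀) x).mul
    (hasDerivAt_const_sub_div p₂ (p₂ - p₁) x)).add
    ((hasDerivAt_const_sub_div p₃ (p₃ - p₁) x).mul
    (hasDerivAt_sub_div p₁ (p₂ - p₁) x))).congr_deriv ?_
  field_simp
  ring

lemma hasDerivAt_quadPiece₂ (h12 : p₂ - p₁ ≠ 0) (h13 : p₃ - p₁ ≠ 0) (x : ℝ) :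
    HasDerivAt (quadPiece₂ p₁ p₂ p₃) (2 / (p₃ - p₁) * ((x - p₁) / (p₂ - p₁))) x := by
  refine ((hasDerivAt_sub_div p₁ (p₃ - p₁) x).mul
    (hasDerivAt_sub_div p₁ (p₂ - p₁) x)).congr_deriv ?_
  field_simp
  ring

/-- The derivatives of the three pieces telescope into differences of consecutive coefficients,
multiplied by the two linear B-splines of the cell. The cases `p₀ = p₁` and `p₂ = p₃` are allowed,
as the end cells require. -/
lemma hasDerivAt_quadPoly (h02 : p₂ - p₀ ≠ 0) (h12 : p₂ - p₁ ≠ 0) (h13 : p₃ - p₁ ≠ 0)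
    (c₀ c₁ c₂ x : ℝ) :
    HasDerivAt (quadPoly p₀ p₁ p₂ p₃ c₀ c₁ c₂)
      (2 * (c₁ - c₀) / (p₂ - p₀) * ((p₂ - x) / (p₂ - p₁))
        + 2 * (c₂ - c₁) / (p₃ - p₁) * ((x - p₁) / (p₂ - p₁))) x := by
  refine ((((hasDerivAt_quadPiece₀ h02 h12 x).const_mul c₀).add
    ((hasDerivAt_quadPiece₁ h02 h12 h13 x).const_mul c₁)).add
    ((hasDerivAt_quadPiece₂ h12 h13 x).const_mul c₂)).congr_deriv ?_
  ring

variable {q₀ q₁ q₂ q₃ q₄ q₅ : ℝ}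

lemma hasDerivAt_cubicPoly (h03 : q₃ - q₀ ≠ 0) (h13 : q₃ - q₁ ≠ 0) (h23 : q₃ - q₂ ≠ 0)
    (h14 : q₄ - q₁ ≠ 0) (h24 : q₄ - q₂ ≠ 0) (h25 : q₅ - q₂ ≠ 0) (c₀ c₁ c₂ c₃ x : ℝ) :
    HasDerivAt (cubicPoly q₀ q₁ q₂ q₃ q₄ q₅ c₀ c₁ c₂ c₃)
      (3 * (c₁ - c₀) / (q₃ - q₀) * quadPiece₀ q₁ q₂ q₃ x
        + 3 * (c₂ - c₁) / (q₄ - q₁) * quadPiece₁ q₁ q₂ q₃ q₄ x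
        + 3 * (c₃ - c₂) / (q₅ - q₂) * quadPiece₂ q₂ q₃ q₄ x) x := by
  have b0 := hasDerivAt_quadPiece₀ h13 h23 x
  have b1 := hasDerivAt_quadPiece₁ h13 h23 h24 x
  have b2 := hasDerivAt_quadPiece₂ h23 h24 x
  refine ((((((hasDerivAt_const_sub_div q₃ (q₃ - q₀) x).mul b0).const_mul c₀).add
    ((((hasDerivAt_sub_div q₀ (q₃ - q₀) x).mul b0).add
      ((hasDerivAt_const_sub_div q₄ (q₄ - q₁) x).mul b1)).const_mul c₁)).add
    ((((hasDerivAt_sub_div q₁ (q₄ - q₁) x).mul b1).add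
      ((hasDerivAt_const_sub_div q₅ (q₅ - q₂) x).mul b2)).const_mul c₂)).add
    ((((hasDerivAt_sub_div q₂ (q₅ - q₂) x).mul b2)).const_mul c₃)).congr_deriv ?_
  simp only [quadPiece₀, quadPiece₁, quadPiece₂]
  field_simp
  ring

/-- De Boor's algorithm at a knot: the coefficient `c₃` drops out. After a shift of knots and
coefficients by one, this is the right side of `cubicPoly_right` on the preceding cell, which gives
continuity. -/
lemma cubicPoly_left (h23 : q₃ - q₂ ≠ 0)
    (c₀ c₁ c₂ c₃ : ℝ) :
    cubicPoly q₀ q₁ q₂ q₃ q₄ q₅ c₀ c₁ c₂ c₃ q₂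
      = (c₀ * (q₃ - q₂) / (q₃ - q₀) + c₁ * (q₂ - q₀) / (q₃ - q₀)) * ((q₃ - q₂) / (q₃ - q₁))
        + (c₁ * (q₄ - q₂) / (q₄ - q₁) + c₂ * (q₂ - q₁) / (q₄ - q₁))
          * ((q₂ - q₁) / (q₃ - q₁)) := by
  simp only [cubicPoly, quadPiece₀, quadPiece₁, quadPiece₂, div_self h23, sub_self, zero_div]
  ring

lemma cubicPoly_right (h23 : q₃ - q₂ ≠ 0)
    (c₀ c₁ c₂ c₃ : ℝ) :
    cubicPoly q₀ q₁ q₂ q₃ q₄ q₅ c₀ c₁ c₂ c₃ q₃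
      = (c₁ * (q₄ - q₃) / (q₄ - q₁) + c₂ * (q₃ - q₁) / (q₄ - q₁)) * ((q₄ - q₃) / (q₄ - q₂))
        + (c₂ * (q₅ - q₃) / (q₅ - q₂) + c₃ * (q₃ - q₂) / (q₅ - q₂))
          * ((q₃ - q₂) / (q₄ - q₂)) := by
  simp only [cubicPoly, quadPiece₀, quadPiece₁, quadPiece₂, div_self h23, sub_self, zero_div]
  ring

end Derivatives

/-! ### Derivatives of splines at midpoints, endpoints and interior knots -/

section Splines

open Set Filter Topology

variable {a b : ℝ} {n : ℕ} {m : ℤ} {x : ℝ}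

lemma InCell.of_lt (h1 : 1 ≤ m) (hn : m ≤ n) (hl : knot a b n (m - 1) ≤ x)
    (hr : x < knot a b n m) : InCell a b n m x :=
  ⟨h1, hn, hl, Or.inl hr⟩

lemma eventually_inCell_Ici (h1 : 1 ≤ m) (hn : m ≤ n) (hl : knot a b n (m - 1) ≤ x)
    (hr : x < knot a b n m) : ∀ᶠ y in 𝓝[≥] x, InCell a b n m y := by
  filter_upwards [Ico_mem_nhdsGE hr] with y hy
  exact .of_lt h1 hn (hl.trans hy.1) hy.2

lemma eventually_inCell_Iio (h1 : 1 ≤ m) (hn : m ≤ n) (hl : knot a b n (m - 1) < x)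
    (hr : x ≤ knot a b n m) : ∀ᶠ y in 𝓝[<] x, InCell a b n m y := by
  filter_upwards [Ico_mem_nhdsLT hl] with y hy
  exact .of_lt h1 hn hy.1 (hy.2.trans_le hr)

lemma eventually_inCell_nhds (h1 : 1 ≤ m) (hn : m ≤ n) (hl : knot a b n (m - 1) < x)
    (hr : x < knot a b n m) : ∀ᶠ y in 𝓝 x, InCell a b n m y := by
  filter_upwards [Ioo_mem_nhds hl hr] with y hy
  exact .of_lt h1 hn hy.1.le hy.2

lemma inCell_right (hab : a < b) (hn : 1 ≤ n) : InCell a b n n b :=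
  ⟨by omega, le_rfl, knot_le_right hab hn _, Or.inr ⟨rfl, rfl⟩⟩

/-- Since the last cell is closed at `b`, it is a neighbourhood of `b` within `[a, b]`. -/
lemma eventually_inCell_right (hab : a < b) (hn : 1 ≤ n) :
    ∀ᶠ y in 𝓝[Icc a b] b, InCell a b n n y := by
  have hl : knot a b n (n - 1) < b := by
    have := knot_lt_knot hab hn (i := n - 1) (j := n) (by omega) (by omega) (by omega)
    rwa [knot_of_ge hn (le_refl (n : ℤ))] at this
  filter_upwards [self_mem_nhdsWithin, mem_nhdsWithin_of_mem_nhds (Ioi_mem_nhds hl)] with y h1 h2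
  rcases h1.2.eq_or_lt with rfl | h
  · exact inCell_right hab hn
  · exact .of_lt (by omega) le_rfl (le_of_lt h2) (by rwa [knot_of_ge hn le_rfl])

lemma eventually_inCell_left (hab : a < b) (hn : 1 ≤ n) :
    ∀ᶠ y in 𝓝[Icc a b] a, InCell a b n 1 y := by
  have hr : a < knot a b n 1 := by
    have := knot_lt_knot hab hn (i := 0) (j := 1) (by omega) (by omega) (by omega)
    rwa [knot_of_nonpos le_rfl] at this
  exact nhdsWithin_mono _ Icc_subset_Ici_self
    (eventually_inCell_Ici le_rfl (by omega) (knot_of_nonpos le_rfl).le hr)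

lemma knot_sub_ne_zero (hab : a < b) (hn : 1 ≤ n) {i j : ℤ} (hij : i < j) (hj : 0 < j)
    (hi : i < n) : knot a b n j - knot a b n i ≠ 0 :=
  (sub_pos.2 (knot_lt_knot hab hn hij hj hi)).ne'

/-- Derivative of a quadratic spline at the midpoint of a cell. -/
lemma hasDerivAt_spline_two_midpoint (hab : a < b) (h1 : 1 ≤ m) (hmn : m ≤ n) (c : ℤ → ℝ) :
    HasDerivAt (fun x => ∑ j ∈ Finset.Icc (1 : ℤ) (n + 2), c j * bspline a b n 2 j x)
      ((c (m + 1) - c m) / (knot a b n m - knot a b n (m - 2))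
        + (c (m + 2) - c (m + 1)) / (knot a b n (m + 1) - knot a b n (m - 1)))
      ((knot a b n (m - 1) + knot a b n m) / 2) := by
  have hn : 1 ≤ n := by omega
  have hlt := knot_lt_knot hab hn (i := m - 1) (j := m) (by omega) (by omega) (by omega)
  have h12 := (sub_pos.2 hlt).ne'
  refine ((hasDerivAt_quadPoly
    (knot_sub_ne_zero hab hn (i := m - 2) (j := m) (by omega) (by omega) (by omega)) h12
    (knot_sub_ne_zero hab hn (i := m - 1) (j := m + 1) (by omega) (by omega) (by omega))
    (c m) (c (m + 1)) (c (m + 2)) _).congr_deriv ?_).congr_of_eventuallyEq ?_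
  -- Both linear B-splines equal `1 / 2` at the midpoint, which cancels the factor `2` from the
  -- degree.
  · rw [show (knot a b n m - (knot a b n (m - 1) + knot a b n m) / 2)
        / (knot a b n m - knot a b n (m - 1)) = 1 / 2 by field_simp; ring,
      show ((knot a b n (m - 1) + knot a b n m) / 2 - knot a b n (m - 1))
        / (knot a b n m - knot a b n (m - 1)) = 1 / 2 by field_simp; ring]
    ring
  · filter_upwards [eventually_inCell_nhds (a := a) (b := b) h1 hmn (by linarith) (by linarith)] with y hy
    exact sum_bspline_two hab hy c

lemma hasDerivWithinAt_spline_two_left (hab : a < b) (hn : 1 ≤ n) (c : ℤ → ℝ) :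
    HasDerivWithinAt (fun x => ∑ j ∈ Finset.Icc (1 : ℤ) (n + 2), c j * bspline a b n 2 j x)
      (2 * (c 2 - c 1) / (knot a b n 1 - a)) (Icc a b) a := by
  have h0 : ∀ i : ℤ, i ≤ 0 → knot a b n i = a := fun i => knot_of_nonpos
  have hne := knot_sub_ne_zero hab hn (i := 0) (j := 1) (by omega) (by omega) (by omega)
  have hne2 := knot_sub_ne_zero hab hn (i := 0) (j := 2) (by omega) (by omega) (by omega)
  rw [h0 0 le_rfl] at hne hne2
  have key := (hasDerivAt_quadPoly hne hne hne2 (c 1) (c 2) (c 3) a).hasDerivWithinAt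
    (s := Icc a b)
  have hev : ∀ y, InCell a b n 1 y → ∑ j ∈ Finset.Icc (1 : ℤ) (n + 2), c j * bspline a b n 2 j y
      = quadPoly a a (knot a b n 1) (knot a b n 2) (c 1) (c 2) (c 3) y := by
    intro y hy
    have := sum_bspline_two hab hy c
    rwa [h0 (1 - 2) (by norm_num), h0 (1 - 1) (by norm_num)] at this
  have hmem := eventually_inCell_left hab hn
  refine (key.congr_deriv ?_).congr_of_eventuallyEq (hmem.mono hev)
    (hev a (hmem.self_of_nhdsWithin (left_mem_Icc.2 hab.le)))
  simp [div_self hne]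

lemma hasDerivWithinAt_spline_two_right (hab : a < b) (hn : 1 ≤ n) (c : ℤ → ℝ) :
    HasDerivWithinAt (fun x => ∑ j ∈ Finset.Icc (1 : ℤ) (n + 2), c j * bspline a b n 2 j x)
      (2 * (c (n + 2) - c (n + 1)) / (b - knot a b n (n - 1))) (Icc a b) b := by
  have h0 : ∀ i : ℤ, n ≤ i → knot a b n i = b := fun i => knot_of_ge hn
  have hne := knot_sub_ne_zero hab hn (i := n - 1) (j := n) (by omega) (by omega) (by omega)
  have hne2 := knot_sub_ne_zero hab hn (i := n - 2) (j := n) (by omega) (by omega) (by omega)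
  rw [h0 n le_rfl] at hne hne2
  have key := (hasDerivAt_quadPoly hne2 hne hne (c n) (c (n + 1)) (c (n + 2)) b).hasDerivWithinAt
    (s := Icc a b)
  have hev : ∀ y, InCell a b n n y → ∑ j ∈ Finset.Icc (1 : ℤ) (n + 2), c j * bspline a b n 2 j y
      = quadPoly (knot a b n (n - 2)) (knot a b n (n - 1)) b b (c n) (c (n + 1)) (c (n + 2)) y := by
    intro y hy
    have := sum_bspline_two hab hy c
    rwa [h0 n le_rfl, h0 (n + 1) (by omega)] at this
  refine (key.congr_deriv ?_).congr_of_eventuallyEq ((eventually_inCell_right hab hn).mono hev)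
    (hev b (inCell_right hab hn))
  simp [div_self hne]

lemma hasDerivWithinAt_spline_three_left (hab : a < b) (hn : 1 ≤ n) (c : ℤ → ℝ) :
    HasDerivWithinAt (fun x => ∑ j ∈ Finset.Icc (1 : ℤ) (n + 3), c j * bspline a b n 3 j x)
      (3 * (c 2 - c 1) / (knot a b n 1 - a)) (Icc a b) a := by
  have h0 : ∀ i : ℤ, i ≤ 0 → knot a b n i = a := fun i => knot_of_nonpos
  have hne := knot_sub_ne_zero hab hn (i := 0) (j := 1) (by omega) (by omega) (by omega)
  have hne2 := knot_sub_ne_zero hab hn (i := 0) (j := 2) (by omega) (by omega) (by omega)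
  have hne3 := knot_sub_ne_zero hab hn (i := 0) (j := 3) (by omega) (by omega) (by omega)
  rw [h0 0 le_rfl] at hne hne2 hne3
  have key := (hasDerivAt_cubicPoly hne hne hne hne2 hne2 hne3
    (c 1) (c 2) (c 3) (c 4) a).hasDerivWithinAt (s := Icc a b)
  have hev : ∀ y, InCell a b n 1 y → ∑ j ∈ Finset.Icc (1 : ℤ) (n + 3), c j * bspline a b n 3 j y
      = cubicPoly a a a (knot a b n 1) (knot a b n 2) (knot a b n 3)
        (c 1) (c 2) (c 3) (c 4) y := by
    intro y hy
    have := sum_bspline_three hab hy c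
    rwa [h0 (1 - 3) (by norm_num), h0 (1 - 2) (by norm_num), h0 (1 - 1) (by norm_num)] at this
  have hmem := eventually_inCell_left hab hn
  refine (key.congr_deriv ?_).congr_of_eventuallyEq (hmem.mono hev)
    (hev a (hmem.self_of_nhdsWithin (left_mem_Icc.2 hab.le)))
  simp [quadPiece₀, quadPiece₁, quadPiece₂, div_self hne]

lemma hasDerivWithinAt_spline_three_right (hab : a < b) (hn : 1 ≤ n) (c : ℤ → ℝ) :
    HasDerivWithinAt (fun x => ∑ j ∈ Finset.Icc (1 : ℤ) (n + 3), c j * bspline a b n 3 j x)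
      (3 * (c (n + 3) - c (n + 2)) / (b - knot a b n (n - 1))) (Icc a b) b := by
  have h0 : ∀ i : ℤ, n ≤ i → knot a b n i = b := fun i => knot_of_ge hn
  have hne := knot_sub_ne_zero hab hn (i := n - 1) (j := n) (by omega) (by omega) (by omega)
  have hne2 := knot_sub_ne_zero hab hn (i := n - 2) (j := n) (by omega) (by omega) (by omega)
  have hne3 := knot_sub_ne_zero hab hn (i := n - 3) (j := n) (by omega) (by omega) (by omega)
  rw [h0 n le_rfl] at hne hne2 hne3
  have key := (hasDerivAt_cubicPoly hne3 hne2 hne hne2 hne hne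
    (c n) (c (n + 1)) (c (n + 2)) (c (n + 3)) b).hasDerivWithinAt (s := Icc a b)
  have hev : ∀ y, InCell a b n n y → ∑ j ∈ Finset.Icc (1 : ℤ) (n + 3), c j * bspline a b n 3 j y
      = cubicPoly (knot a b n (n - 3)) (knot a b n (n - 2)) (knot a b n (n - 1)) b b b
        (c n) (c (n + 1)) (c (n + 2)) (c (n + 3)) y := by
    intro y hy
    have := sum_bspline_three hab hy c
    rwa [h0 n le_rfl, h0 (n + 1) (by omega), h0 (n + 2) (by omega)] at this
  refine (key.congr_deriv ?_).congr_of_eventuallyEq ((eventually_inCell_right hab hn).mono hev)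
    (hev b (inCell_right hab hn))
  simp [quadPiece₀, quadPiece₁, quadPiece₂, div_self hne]

/-- Derivative of a cubic spline at an interior knot. -/
lemma hasDerivAt_spline_three_knot (hab : a < b) (h1 : 1 ≤ m) (hmn : m < n) (c : ℤ → ℝ) :
    HasDerivAt (fun x => ∑ j ∈ Finset.Icc (1 : ℤ) (n + 3), c j * bspline a b n 3 j x)
      (3 * (c (m + 2) - c (m + 1)) / (knot a b n (m + 1) - knot a b n (m - 2))
          * ((knot a b n (m + 1) - knot a b n m) / (knot a b n (m + 1) - knot a b n (m - 1)))
        + 3 * (c (m + 3) - c (m + 2)) / (knot a b n (m + 2) - knot a b n (m - 1))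
          * ((knot a b n m - knot a b n (m - 1)) / (knot a b n (m + 1) - knot a b n (m - 1))))
      (knot a b n m) := by
  have hn : 1 ≤ n := by omega
  have hne : ∀ i j : ℤ, i < j ∧ 0 < j ∧ i < n → knot a b n j - knot a b n i ≠ 0 :=
    fun i j h => knot_sub_ne_zero hab hn h.1 h.2.1 h.2.2
  have hl := knot_lt_knot hab hn (i := m - 1) (j := m) (by omega) (by omega) (by omega)
  have hr := knot_lt_knot hab hn (i := m) (j := m + 1) (by omega) (by omega) (by omega)
  have keyl := hasDerivAt_cubicPoly (hne (m - 3) m (by omega)) (hne (m - 2) m (by omega))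
    (hne (m - 1) m (by omega)) (hne (m - 2) (m + 1) (by omega)) (hne (m - 1) (m + 1) (by omega))
    (hne (m - 1) (m + 2) (by omega)) (c m) (c (m + 1)) (c (m + 2)) (c (m + 3)) (knot a b n m)
  have keyr := hasDerivAt_cubicPoly (hne (m - 2) (m + 1) (by omega))
    (hne (m - 1) (m + 1) (by omega)) (hne m (m + 1) (by omega)) (hne (m - 1) (m + 2) (by omega))
    (hne m (m + 2) (by omega)) (hne m (m + 3) (by omega))
    (c (m + 1)) (c (m + 2)) (c (m + 3)) (c (m + 4)) (knot a b n m)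
  have evr : ∀ y, InCell a b n (m + 1) y →
      ∑ j ∈ Finset.Icc (1 : ℤ) (n + 3), c j * bspline a b n 3 j y
      = cubicPoly (knot a b n (m - 2)) (knot a b n (m - 1)) (knot a b n m) (knot a b n (m + 1))
        (knot a b n (m + 2)) (knot a b n (m + 3))
        (c (m + 1)) (c (m + 2)) (c (m + 3)) (c (m + 4)) y := by
    intro y hy
    have := sum_bspline_three hab hy c
    rwa [show m + 1 - 3 = m - 2 by ring, show m + 1 - 2 = m - 1 by ring,
      show m + 1 - 1 = m by ring, show m + 1 + 1 = m + 2 by ring,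
      show m + 1 + 2 = m + 3 by ring, show m + 1 + 3 = m + 4 by ring] at this
  have cellr : InCell a b n (m + 1) (knot a b n m) :=
    .of_lt (by omega) (by omega) (by rw [add_sub_cancel_right]) hr
  have hval := evr _ cellr
  -- The knot `x_m` belongs to cell `m + 1`, so the polynomial of cell `m` represents the spline
  -- only to the left of it. A left derivative also needs the value at `x_m`, which is where
  -- continuity enters.
  have hvl : ∑ j ∈ Finset.Icc (1 : ℤ) (n + 3), c j * bspline a b n 3 j (knot a b n m)
      = cubicPoly (knot a b n (m - 3)) (knot a b n (m - 2)) (knot a b n (m - 1)) (knot a b n m)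
        (knot a b n (m + 1)) (knot a b n (m + 2))
        (c m) (c (m + 1)) (c (m + 2)) (c (m + 3)) (knot a b n m) := by
    rw [hval, cubicPoly_left (hne m (m + 1) (by omega)),
      cubicPoly_right (hne (m - 1) m (by omega))]
  have dl := (keyl.hasDerivWithinAt (s := Iio (knot a b n m))).congr_of_eventuallyEq
    ((eventually_inCell_Iio h1 hmn.le hl le_rfl).mono fun y hy => sum_bspline_three hab hy c) hvl
  have dr := (keyr.hasDerivWithinAt (s := Ici (knot a b n m))).congr_of_eventuallyEq
    ((eventually_inCell_Ici (by omega) (by omega) cellr.knot_le hr).mono evr) hval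
  rw [← hasDerivWithinAt_univ, ← Iio_union_Ici (a := knot a b n m)]
  refine (dl.congr_deriv ?_).union (dr.congr_deriv ?_)
  -- The first quadratic piece vanishes at the right end of its cell and, in the next goal, the last
  -- one at the left end; the same two terms remain from both sides.
  · simp only [quadPiece₀, quadPiece₁, quadPiece₂, div_self (hne (m - 1) m (by omega)), sub_self,
      zero_div]
    ring
  · simp only [quadPiece₀, quadPiece₁, quadPiece₂, div_self (hne m (m + 1) (by omega)), sub_self,
      zero_div]
    ring

end Splines

/-! ### Matrix rows as finite sums, and bandedness -/

section Rows

lemma rowFrom_nil (s k : ℤ) : rowFrom s [] k = 0 := by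
  simp [rowFrom]

/-- Writing the head as a Kronecker delta lets a row be summed against a vector one entry at a time.
-/
lemma rowFrom_cons (s : ℤ) (x : ℝ) (l : List ℝ) (k : ℤ) :
    rowFrom s (x :: l) k = (if k = s then x else 0) + rowFrom (s + 1) l k := by
  rcases lt_trichotomy k s with h | rfl | h
  · simp [rowFrom, not_le.2 h, h.ne, show ¬ s + 1 ≤ k by omega]
  · simp [rowFrom]
  · have : (k - s).toNat = (k - (s + 1)).toNat + 1 := by omega
    simp [rowFrom, h.le, h.ne', show s + 1 ≤ k by omega, this]

lemma rowFrom_eq_zero {s k : ℤ} {l : List ℝ} (h : k < s ∨ s + l.length ≤ k) :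
    rowFrom s l k = 0 := by
  unfold rowFrom
  split_ifs
  · exact List.getD_eq_default _ _ (by omega)
  · rfl

lemma sum_rowFrom_nil (A : Finset ℤ) (s : ℤ) (g : ℤ → ℝ) :
    ∑ k ∈ A, rowFrom s [] k * g k = 0 := by
  simp [rowFrom_nil]

lemma sum_rowFrom_cons {A : Finset ℤ} {s : ℤ} (hs : s ∈ A) (x : ℝ) (l : List ℝ) (g : ℤ → ℝ) :
    ∑ k ∈ A, rowFrom s (x :: l) k * g k = x * g s + ∑ k ∈ A, rowFrom (s + 1) l k * g k := by
  simp only [rowFrom_cons, add_mul, Finset.sum_add_distrib, ite_mul, zero_mul,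
    Finset.sum_ite_eq', hs, if_true]

lemma sum_fin_eq_sum_Icc (N : ℕ) (s : ℤ) (g : ℤ → ℝ) :
    ∑ k : Fin N, g ((k : ℕ) + s) = ∑ k ∈ Finset.Icc s (s + N - 1), g k := by
  refine Finset.sum_bij (fun k _ => ((k : ℕ) : ℤ) + s) ?_ ?_ ?_ ?_
  · intro k _
    have := k.2
    simp only [Finset.mem_Icc]
    omega
  · intro k _ l _ h
    ext
    omega
  · intro k hk
    rw [Finset.mem_Icc] at hk
    exact ⟨⟨(k - s).toNat, by omega⟩, Finset.mem_univ _, by simp; omega⟩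
  · intros
    rfl

lemma D2_mulVec (a b : ℝ) (n : ℕ) (g : ℤ → ℝ) (i : Fin (n + 2)) :
    (D2 a b n).mulVec (fun k : Fin (n + 2) => g ((k : ℕ) + 1)) i
      = (∑ k ∈ Finset.Icc (1 : ℤ) (n + 2), D2entry n ((i : ℕ) + 1) k * g k) / mesh a b n := by
  have := sum_fin_eq_sum_Icc (n + 2) 1 fun k => D2entry n ((i : ℕ) + 1) k / mesh a b n * g k
  rw [show (1 : ℤ) + ((n + 2 : ℕ) : ℤ) - 1 = n + 2 by push_cast; ring] at this
  simp only [Matrix.mulVec, dotProduct, D2, Matrix.of_apply]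
  rw [this, Finset.sum_div]
  exact Finset.sum_congr rfl fun k _ => by ring

lemma D3_mulVec (a b : ℝ) (n : ℕ) (g : ℤ → ℝ) (i : Fin (n + 1)) :
    (D3 a b n).mulVec (fun k : Fin (n + 1) => g (k : ℕ)) i
      = (∑ k ∈ Finset.Icc (0 : ℤ) n, D3entry n (i : ℕ) k * g k) / mesh a b n := by
  have := sum_fin_eq_sum_Icc (n + 1) 0 fun k => D3entry n (i : ℕ) k / mesh a b n * g k
  rw [show (0 : ℤ) + ((n + 1 : ℕ) : ℤ) - 1 = n by push_cast; ring] at this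
  simp only [add_zero] at this
  simp only [Matrix.mulVec, dotProduct, D3, Matrix.of_apply]
  rw [this, Finset.sum_div]
  exact Finset.sum_congr rfl fun k _ => by ring

lemma D2_eq_zero (a b : ℝ) {n : ℕ} (i k : Fin (n + 2))
    (h : 2 < |((i : ℕ) : ℤ) - ((k : ℕ) : ℤ)|) : D2 a b n i k = 0 := by
  rw [lt_abs] at h
  simp only [D2, Matrix.of_apply, D2entry]
  split_ifs <;> rw [rowFrom_eq_zero, zero_div] <;> simp only [List.length_cons, List.length_nil] <;>
    omega

lemma D3_eq_zero (a b : ℝ) {n : ℕ} (i k : Fin (n + 1))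
    (h : 3 < |((i : ℕ) : ℤ) - ((k : ℕ) : ℤ)|) : D3 a b n i k = 0 := by
  rw [lt_abs] at h
  simp only [D3, Matrix.of_apply, D3entry]
  split_ifs <;> rw [rowFrom_eq_zero, zero_div] <;> simp only [List.length_cons, List.length_nil] <;>
    omega

end Rows

/-! ### Rows with three, four and five entries -/

section RowSums

variable {A : Finset ℤ} {s : ℤ}

/-- The columns are separate arguments, so that they can be given in the normal form (`n + 1`
instead of `n - 1 + 2`) in which the values of `f` appear elsewhere. -/
lemma sum_rowFrom_three (g : ℤ → ℝ) (x₀ x₁ x₂ : ℝ) (i₁ i₂ : ℤ) (h₁ : i₁ = s + 1)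
    (h₂ : i₂ = s + 2) (hs : s ∈ A) (m₁ : i₁ ∈ A) (m₂ : i₂ ∈ A) :
    ∑ k ∈ A, rowFrom s [x₀, x₁, x₂] k * g k = x₀ * g s + x₁ * g i₁ + x₂ * g i₂ := by
  obtain rfl : i₂ = i₁ + 1 := by omega
  subst h₁
  rw [sum_rowFrom_cons hs, sum_rowFrom_cons m₁, sum_rowFrom_cons m₂, sum_rowFrom_nil]
  ring

lemma sum_rowFrom_four (g : ℤ → ℝ) (x₀ x₁ x₂ x₃ : ℝ) (i₁ i₂ i₃ : ℤ) (h₁ : i₁ = s + 1)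
    (h₂ : i₂ = s + 2) (h₃ : i₃ = s + 3) (hs : s ∈ A) (m₁ : i₁ ∈ A) (m₂ : i₂ ∈ A) (m₃ : i₃ ∈ A) :
    ∑ k ∈ A, rowFrom s [x₀, x₁, x₂, x₃] k * g k
      = x₀ * g s + x₁ * g i₁ + x₂ * g i₂ + x₃ * g i₃ := by
  subst h₁
  rw [sum_rowFrom_cons hs, sum_rowFrom_three g x₁ x₂ x₃ i₂ i₃ (by omega) (by omega) m₁ m₂ m₃]
  ring

lemma sum_rowFrom_five (g : ℤ → ℝ) (x₀ x₁ x₂ x₃ x₄ : ℝ) (i₁ i₂ i₃ i₄ : ℤ) (h₁ : i₁ = s + 1)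
    (h₂ : i₂ = s + 2) (h₃ : i₃ = s + 3) (h₄ : i₄ = s + 4) (hs : s ∈ A) (m₁ : i₁ ∈ A)
    (m₂ : i₂ ∈ A) (m₃ : i₃ ∈ A) (m₄ : i₄ ∈ A) :
    ∑ k ∈ A, rowFrom s [x₀, x₁, x₂, x₃, x₄] k * g k
      = x₀ * g s + x₁ * g i₁ + x₂ * g i₂ + x₃ * g i₃ + x₄ * g i₄ := by
  subst h₁
  rw [sum_rowFrom_cons hs, sum_rowFrom_four g x₁ x₂ x₃ x₄ i₂ i₃ i₄ (by omega) (by omega)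
    (by omega) m₁ m₂ m₃ m₄]
  ring

end RowSums

/-! ### Values of the coefficient functionals -/

section Coefficients

variable (a b : ℝ) {n : ℕ} (f : ℝ → ℝ) {j : ℤ}

lemma mu2_first (hj : j = 1) : mu2 a b n f j = f (tPoint a b n 1) := by
  simp [mu2, hj]

lemma mu2_second (hj : j = 2) :
    mu2 a b n f j = 1 / 6 * (-2 * f (tPoint a b n 1) + 9 * f (tPoint a b n 2)
      - f (tPoint a b n 3)) := by
  simp [mu2, hj]

lemma mu2_mid (h3 : 3 ≤ j) (hn : j ≤ n) (i l k : ℤ) (hi : i = j - 1) (hl : l = j)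
    (hk : k = j + 1) :
    mu2 a b n f j = 1 / 8 * (-f (tPoint a b n i) + 10 * f (tPoint a b n l)
      - f (tPoint a b n k)) := by
  subst hi hl hk
  rw [mu2, if_neg (by omega), if_neg (by omega), if_neg (by omega), if_neg (by omega)]

lemma mu2_penultimate (hn : 2 ≤ n) (hj : j = n + 1) :
    mu2 a b n f j = 1 / 6 * (-f (tPoint a b n n) + 9 * f (tPoint a b n (n + 1))
      - 2 * f (tPoint a b n (n + 2))) := by
  rw [mu2, if_neg (by omega), if_neg (by omega), if_pos hj]

lemma mu2_last (hn : 1 ≤ n) (hj : j = n + 2) : mu2 a b n f j = f (tPoint a b n (n + 2)) := by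
  rw [mu2, if_neg (by omega), if_neg (by omega), if_neg (by omega), if_pos hj]

lemma mu3_first (hj : j = 1) : mu3 a b n f j = f (knot a b n 0) := by
  simp [mu3, hj]

lemma mu3_second (hj : j = 2) :
    mu3 a b n f j = 1 / 18 * (7 * f (knot a b n 0) + 18 * f (knot a b n 1)
      - 9 * f (knot a b n 2) + 2 * f (knot a b n 3)) := by
  simp [mu3, hj]

lemma mu3_mid (h3 : 3 ≤ j) (hn : j ≤ n + 1) (i l k : ℤ) (hi : i = j - 3) (hl : l = j - 2)
    (hk : k = j - 1) :
    mu3 a b n f j = 1 / 6 * (-f (knot a b n i) + 8 * f (knot a b n l) - f (knot a b n k)) := by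
  subst hi hl hk
  rw [mu3, if_neg (by omega), if_neg (by omega), if_neg (by omega), if_neg (by omega)]

lemma mu3_penultimate (hn : 1 ≤ n) (hj : j = n + 2) :
    mu3 a b n f j = 1 / 18 * (2 * f (knot a b n (n - 3)) - 9 * f (knot a b n (n - 2))
      + 18 * f (knot a b n (n - 1)) + 7 * f (knot a b n n)) := by
  rw [mu3, if_neg (by omega), if_neg (by omega), if_pos hj]

lemma mu3_last (hn : 1 ≤ n) (hj : j = n + 3) : mu3 a b n f j = f (knot a b n n) := by
  rw [mu3, if_neg (by omega), if_neg (by omega), if_neg (by omega), if_pos hj]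

end Coefficients

/-! ### The quadratic quasi-interpolant -/

section Quadratic

variable {a b : ℝ} {n : ℕ} {j : ℤ} {f : ℝ → ℝ}

lemma knot_sub_knot (hn : 1 ≤ n) {i k : ℤ} (p : ℤ) (hp : p = max 0 (min k n) - max 0 (min i n)) :
    knot a b n k - knot a b n i = p * mesh a b n := by
  rw [knot_eq_clamp hn, knot_eq_clamp hn, hp]
  push_cast
  ring

/-- The point `t_j` is the midpoint of cell `j - 1`. The integers `p` and `q` count the mesh lengths
in `x_{j-1} - x_{j-3}` and `x_j - x_{j-2}`: two, except next to the ends. -/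
lemma hasDerivAt_Q2 (hab : a < b) (h2 : 2 ≤ j) (hj : j ≤ n + 1) {c₀ c₁ c₂ : ℝ} (p q : ℤ)
    (h₀ : mu2 a b n f (j - 1) = c₀) (h₁ : mu2 a b n f j = c₁) (h₂ : mu2 a b n f (j + 1) = c₂)
    (hp : p = max 0 (min (j - 1) n) - max 0 (min (j - 3) n))
    (hq : q = max 0 (min j n) - max 0 (min (j - 2) n)) :
    HasDerivAt (Q2 a b n f)
      ((c₁ - c₀) / (p * mesh a b n) + (c₂ - c₁) / (q * mesh a b n)) (tPoint a b n j) := by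
  have hn : 1 ≤ n := by omega
  have := hasDerivAt_spline_two_midpoint hab (n := n) (m := j - 1) (by omega) (by omega) (mu2 a b n f)
  rw [show j - 1 + 1 = j by ring, show j - 1 + 2 = j + 1 by ring, show j - 1 - 1 = j - 2 by ring,
    show j - 1 - 2 = j - 3 by ring, h₀, h₁, h₂, knot_sub_knot hn p hp,
    knot_sub_knot hn q hq] at this
  exact this

lemma hasDerivAt_Q2_mid (hab : a < b) (h4 : 4 ≤ j) (hj : j ≤ n - 1) :
    HasDerivAt (Q2 a b n f)
      ((1 / 16 * f (tPoint a b n (j - 2)) - 5 / 8 * f (tPoint a b n (j - 1))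
        + 0 * f (tPoint a b n j) + 5 / 8 * f (tPoint a b n (j + 1))
        - 1 / 16 * f (tPoint a b n (j + 2))) / mesh a b n) (tPoint a b n j) := by
  have hn : 1 ≤ n := by omega
  have h0 := (mesh_pos hab hn).ne'
  refine (hasDerivAt_Q2 hab (by omega) (by omega) 2 2
    (mu2_mid a b f (by omega) (by omega) (j - 2) (j - 1) j (by omega) (by omega) (by omega))
    (mu2_mid a b f (by omega) (by omega) (j - 1) j (j + 1) (by omega) (by omega) (by omega))
    (mu2_mid a b f (by omega) (by omega) j (j + 1) (j + 2) (by omega) (by omega) (by omega))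
    (by omega) (by omega)).congr_deriv ?_
  push_cast
  field_simp
  ring

lemma tPoint_one : tPoint a b n 1 = a := by
  rw [tPoint, knot_of_nonpos (by omega), knot_of_nonpos (by omega)]
  ring

lemma tPoint_last (hn : 1 ≤ n) : tPoint a b n (n + 2) = b := by
  rw [tPoint, knot_of_ge hn (by omega), knot_of_ge hn (by omega)]
  ring

lemma knot_one_sub_left (hn : 1 ≤ n) : knot a b n 1 - a = mesh a b n := by
  rw [knot_of_mem hn (by omega) (by omega)]
  push_cast
  ring

lemma right_sub_knot (hn : 1 ≤ n) : b - knot a b n (n - 1) = mesh a b n := by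
  nth_rw 1 [← knot_of_ge (a := a) (b := b) hn (le_refl (n : ℤ))]
  rw [knot_sub_knot hn 1 (by omega)]
  push_cast
  ring

lemma hasDerivWithinAt_Q2 (hab : a < b) (hn : 4 ≤ n) (h1 : 1 ≤ j) (hj : j ≤ n + 2) :
    HasDerivWithinAt (Q2 a b n f)
      ((∑ k ∈ Finset.Icc (1 : ℤ) (n + 2), D2entry n j k * f (tPoint a b n k)) / mesh a b n)
      (Set.Icc a b) (tPoint a b n j) := by
  have hn1 : 1 ≤ n := by omega
  have h0 := (mesh_pos hab hn1).ne'
  have mem : ∀ k : ℤ, 1 ≤ k ∧ k ≤ n + 2 → k ∈ Finset.Icc (1 : ℤ) (n + 2) :=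
    fun k hk => Finset.mem_Icc.2 hk
  -- For `n ≥ 4` rows `3` and `n` are distinct, and `μ_3, μ_4, μ_{n-1}, μ_n`, which they use, are
  -- all of the interior type.
  obtain rfl | rfl | rfl | ⟨h4, hj'⟩ | rfl | rfl | rfl : j = 1 ∨ j = 2 ∨ j = 3 ∨
      (4 ≤ j ∧ j ≤ n - 1) ∨ j = n ∨ j = n + 1 ∨ j = n + 2 := by omega
  · simp only [D2entry, if_true]
    rw [sum_rowFrom_three (fun k => f (tPoint a b n k)) _ _ _ 2 3 (by omega) (by omega)
      (mem _ (by omega)) (mem _ (by omega)) (mem _ (by omega))]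
    have := hasDerivWithinAt_spline_two_left hab hn1 (mu2 a b n f)
    rw [knot_one_sub_left hn1, mu2_first a b f rfl, mu2_second a b f rfl] at this
    rw [tPoint_one] at *
    refine this.congr_deriv ?_
    field_simp
    ring
  · simp only [D2entry, show ¬ ((2 : ℤ) = (1 : ℤ)) by omega,
      if_true,
      if_false]
    rw [sum_rowFrom_four (fun k => f (tPoint a b n k)) _ _ _ _ 2 3 4
      (by omega) (by omega) (by omega)
      (mem _ (by omega)) (mem _ (by omega)) (mem _ (by omega)) (mem _ (by omega))]
    -- Here `x_1 - x_{-1} = h` because `x_{-1} = x_0 = a`.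
    refine (hasDerivAt_Q2 hab (by omega) (by omega) 1 2
      (mu2_first a b f (by omega))
      (mu2_second a b f (by omega))
      (mu2_mid a b f (by omega) (by omega) 2 3 4 (by omega) (by omega) (by omega))
      (by omega) (by omega)).hasDerivWithinAt.congr_deriv ?_
    push_cast
    field_simp
    ring
  · simp only [D2entry, show ¬ ((3 : ℤ) = (1 : ℤ)) by omega,
      show ¬ ((3 : ℤ) = (2 : ℤ)) by omega,
      if_true,
      if_false]
    rw [sum_rowFrom_five (fun k => f (tPoint a b n k)) _ _ _ _ _ 2 3 4 5
      (by omega) (by omega) (by omega) (by omega)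
      (mem _ (by omega)) (mem _ (by omega)) (mem _ (by omega)) (mem _ (by omega)) (mem _ (by omega))]
    refine (hasDerivAt_Q2 hab (by omega) (by omega) 2 2
      (mu2_second a b f (by omega))
      (mu2_mid a b f (by omega) (by omega) 2 3 4 (by omega) (by omega) (by omega))
      (mu2_mid a b f (by omega) (by omega) 3 4 5 (by omega) (by omega) (by omega))
      (by omega) (by omega)).hasDerivWithinAt.congr_deriv ?_
    push_cast
    field_simp
    ring
  · simp only [D2entry, show ¬ (j = (1 : ℤ)) by omega,
      show ¬ (j = (2 : ℤ)) by omega,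
      show ¬ (j = (3 : ℤ)) by omega,
      show ¬ (j = (n : ℤ)) by omega,
      show ¬ (j = (n + 1 : ℤ)) by omega,
      show ¬ (j = (n + 2 : ℤ)) by omega,
      if_false]
    rw [sum_rowFrom_five (fun k => f (tPoint a b n k)) _ _ _ _ _ (j - 1) j (j + 1) (j + 2)
      (by omega) (by omega) (by omega) (by omega)
      (mem _ (by omega)) (mem _ (by omega)) (mem _ (by omega)) (mem _ (by omega)) (mem _ (by omega))]
    refine (hasDerivAt_Q2_mid hab h4 hj').hasDerivWithinAt.congr_deriv ?_
    ring
  · simp only [D2entry, show ¬ ((n : ℤ) = (1 : ℤ)) by omega,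
      show ¬ ((n : ℤ) = (2 : ℤ)) by omega,
      show ¬ ((n : ℤ) = (3 : ℤ)) by omega,
      if_true,
      if_false]
    rw [sum_rowFrom_five (fun k => f (tPoint a b n k)) _ _ _ _ _ (n - 1) n (n + 1) (n + 2)
      (by omega) (by omega) (by omega) (by omega)
      (mem _ (by omega)) (mem _ (by omega)) (mem _ (by omega)) (mem _ (by omega)) (mem _ (by omega))]
    refine (hasDerivAt_Q2 hab (by omega) (by omega) 2 2
      (mu2_mid a b f (by omega) (by omega) (n - 2) (n - 1) n (by omega) (by omega) (by omega))
      (mu2_mid a b f (by omega) (by omega) (n - 1) n (n + 1) (by omega) (by omega) (by omega))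
      (mu2_penultimate a b f (by omega) (by omega))
      (by omega) (by omega)).hasDerivWithinAt.congr_deriv ?_
    push_cast
    field_simp
    ring
  · simp only [D2entry, show ¬ ((n + 1 : ℤ) = (1 : ℤ)) by omega,
      show ¬ ((n + 1 : ℤ) = (2 : ℤ)) by omega,
      show ¬ ((n + 1 : ℤ) = (3 : ℤ)) by omega,
      show ¬ ((n + 1 : ℤ) = (n : ℤ)) by omega,
      if_true,
      if_false]
    rw [sum_rowFrom_four (fun k => f (tPoint a b n k)) _ _ _ _ n (n + 1) (n + 2)
      (by omega) (by omega) (by omega)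
      (mem _ (by omega)) (mem _ (by omega)) (mem _ (by omega)) (mem _ (by omega))]
    -- Symmetrically, `x_{n+1} - x_{n-1} = h`.
    refine (hasDerivAt_Q2 hab (by omega) (by omega) 2 1
      (mu2_mid a b f (by omega) (by omega) (n - 1) n (n + 1) (by omega) (by omega) (by omega))
      (mu2_penultimate a b f (by omega) (by omega))
      (mu2_last a b f (by omega) (by omega))
      (by omega) (by omega)).hasDerivWithinAt.congr_deriv ?_
    push_cast
    field_simp
    ring
  · simp only [D2entry, show ¬ ((n + 2 : ℤ) = (1 : ℤ)) by omega,
      show ¬ ((n + 2 : ℤ) = (2 : ℤ)) by omega,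
      show ¬ ((n + 2 : ℤ) = (3 : ℤ)) by omega,
      show ¬ ((n + 2 : ℤ) = (n : ℤ)) by omega,
      show ¬ ((n + 2 : ℤ) = (n + 1 : ℤ)) by omega,
      if_true,
      if_false]
    rw [sum_rowFrom_three (fun k => f (tPoint a b n k)) _ _ _ (n + 1) (n + 2)
      (by omega) (by omega)
      (mem _ (by omega)) (mem _ (by omega)) (mem _ (by omega))]
    have := hasDerivWithinAt_spline_two_right hab hn1 (mu2 a b n f)
    rw [right_sub_knot hn1, mu2_penultimate a b f (by omega) rfl,
      mu2_last a b f hn1 rfl] at this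
    rw [tPoint_last hn1] at *
    refine this.congr_deriv ?_
    field_simp
    ring

end Quadratic

/-! ### The cubic quasi-interpolant -/

section Cubic

variable {a b : ℝ} {n : ℕ} {j : ℤ} {f : ℝ → ℝ}

/-- The two quadratic B-splines that do not vanish at an interior knot both equal `h / (2h)` there,
whence the division by `2`. -/
lemma hasDerivAt_Q3 (hab : a < b) (h1 : 1 ≤ j) (hj : j < n) {c₁ c₂ c₃ : ℝ} (p q : ℤ)
    (h₁ : mu3 a b n f (j + 1) = c₁) (h₂ : mu3 a b n f (j + 2) = c₂)
    (h₃ : mu3 a b n f (j + 3) = c₃)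
    (hp : p = max 0 (min (j + 1) n) - max 0 (min (j - 2) n))
    (hq : q = max 0 (min (j + 2) n) - max 0 (min (j - 1) n)) :
    HasDerivAt (Q3 a b n f)
      ((3 * (c₂ - c₁) / (p * mesh a b n) + 3 * (c₃ - c₂) / (q * mesh a b n)) / 2)
      (knot a b n j) := by
  have hn : 1 ≤ n := by omega
  have h0 := (mesh_pos hab hn).ne'
  have := hasDerivAt_spline_three_knot hab h1 hj (mu3 a b n f)
  rw [h₁, h₂, h₃, knot_sub_knot hn p hp, knot_sub_knot hn q hq,
    knot_sub_knot hn (i := j) (k := j + 1) 1 (by omega),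
    knot_sub_knot hn (i := j - 1) (k := j + 1) 2 (by omega),
    knot_sub_knot hn (i := j - 1) (k := j) 1 (by omega),
    show ((1 : ℤ) : ℝ) * mesh a b n / (((2 : ℤ) : ℝ) * mesh a b n) = 1 / 2 by
      push_cast; field_simp] at this
  exact this.congr_deriv (by ring)

lemma hasDerivAt_Q3_mid (hab : a < b) (h2 : 2 ≤ j) (hj : j ≤ n - 2) :
    HasDerivAt (Q3 a b n f)
      ((1 / 12 * f (knot a b n (j - 2)) - 2 / 3 * f (knot a b n (j - 1))
        + 0 * f (knot a b n j) + 2 / 3 * f (knot a b n (j + 1))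
        - 1 / 12 * f (knot a b n (j + 2))) / mesh a b n) (knot a b n j) := by
  have hn : 1 ≤ n := by omega
  have h0 := (mesh_pos hab hn).ne'
  refine (hasDerivAt_Q3 hab (by omega) (by omega) 3 3
    (mu3_mid a b f (by omega) (by omega) (j - 2) (j - 1) j (by omega) (by omega) (by omega))
    (mu3_mid a b f (by omega) (by omega) (j - 1) j (j + 1) (by omega) (by omega) (by omega))
    (mu3_mid a b f (by omega) (by omega) j (j + 1) (j + 2) (by omega) (by omega) (by omega))
    (by omega) (by omega)).congr_deriv ?_
  push_cast
  field_simp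
  ring

lemma hasDerivWithinAt_Q3 (hab : a < b) (hn : 3 ≤ n) (h1 : 0 ≤ j) (hj : j ≤ n) :
    HasDerivWithinAt (Q3 a b n f)
      ((∑ k ∈ Finset.Icc (0 : ℤ) n, D3entry n j k * f (knot a b n k)) / mesh a b n)
      (Set.Icc a b) (knot a b n j) := by
  have hn1 : 1 ≤ n := by omega
  have h0 := (mesh_pos hab hn1).ne'
  have mem : ∀ k : ℤ, 0 ≤ k ∧ k ≤ n → k ∈ Finset.Icc (0 : ℤ) n :=
    fun k hk => Finset.mem_Icc.2 hk
  obtain rfl | rfl | ⟨h2, hj'⟩ | rfl | rfl : j = 0 ∨ j = 1 ∨ (2 ≤ j ∧ j ≤ n - 2) ∨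
      j = n - 1 ∨ j = n := by omega
  · simp only [D3entry, if_true]
    rw [sum_rowFrom_four (fun k => f (knot a b n k)) _ _ _ _ 1 2 3
      (by omega) (by omega) (by omega)
      (mem _ (by omega)) (mem _ (by omega)) (mem _ (by omega)) (mem _ (by omega))]
    have := hasDerivWithinAt_spline_three_left hab hn1 (mu3 a b n f)
    rw [knot_one_sub_left hn1, mu3_first a b f rfl, mu3_second a b f rfl] at this
    rw [knot_of_nonpos le_rfl] at *
    refine this.congr_deriv ?_
    field_simp
    ring
  · simp only [D3entry, show ¬ ((1 : ℤ) = (0 : ℤ)) by omega,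
      if_true,
      if_false]
    rw [sum_rowFrom_four (fun k => f (knot a b n k)) _ _ _ _ 1 2 3
      (by omega) (by omega) (by omega)
      (mem _ (by omega)) (mem _ (by omega)) (mem _ (by omega)) (mem _ (by omega))]
    -- The repeated knot shortens `x_2 - x_{-1}` to `2h`. The coefficient `μ_4` is of the interior
    -- type because `n ≥ 3`.
    refine (hasDerivAt_Q3 hab (by omega) (by omega) 2 3
      (mu3_second a b f (by omega))
      (mu3_mid a b f (by omega) (by omega) 0 1 2 (by omega) (by omega) (by omega))
      (mu3_mid a b f (by omega) (by omega) 1 2 3 (by omega) (by omega) (by omega))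
      (by omega) (by omega)).hasDerivWithinAt.congr_deriv ?_
    push_cast
    field_simp
    ring
  · simp only [D3entry, show ¬ (j = (0 : ℤ)) by omega,
      show ¬ (j = (1 : ℤ)) by omega,
      show ¬ (j = (n - 1 : ℤ)) by omega,
      show ¬ (j = (n : ℤ)) by omega,
      if_false]
    rw [sum_rowFrom_five (fun k => f (knot a b n k)) _ _ _ _ _ (j - 1) j (j + 1) (j + 2)
      (by omega) (by omega) (by omega) (by omega)
      (mem _ (by omega)) (mem _ (by omega)) (mem _ (by omega)) (mem _ (by omega)) (mem _ (by omega))]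
    refine (hasDerivAt_Q3_mid hab h2 hj').hasDerivWithinAt.congr_deriv ?_
    ring
  · simp only [D3entry, show ¬ ((n - 1 : ℤ) = (0 : ℤ)) by omega,
      show ¬ ((n - 1 : ℤ) = (1 : ℤ)) by omega,
      if_true,
      if_false]
    rw [sum_rowFrom_four (fun k => f (knot a b n k)) _ _ _ _ (n - 2) (n - 1) n
      (by omega) (by omega) (by omega)
      (mem _ (by omega)) (mem _ (by omega)) (mem _ (by omega)) (mem _ (by omega))]
    refine (hasDerivAt_Q3 hab (by omega) (by omega) 3 2
      (mu3_mid a b f (by omega) (by omega) (n - 3) (n - 2) (n - 1) (by omega) (by omega) (by omega))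
      (mu3_mid a b f (by omega) (by omega) (n - 2) (n - 1) n (by omega) (by omega) (by omega))
      (mu3_penultimate a b f (by omega) (by omega))
      (by omega) (by omega)).hasDerivWithinAt.congr_deriv ?_
    push_cast
    field_simp
    ring
  · simp only [D3entry, show ¬ ((n : ℤ) = (0 : ℤ)) by omega,
      show ¬ ((n : ℤ) = (1 : ℤ)) by omega,
      show ¬ ((n : ℤ) = (n - 1 : ℤ)) by omega,
      if_true,
      if_false]
    rw [sum_rowFrom_four (fun k => f (knot a b n k)) _ _ _ _ (n - 2) (n - 1) n
      (by omega) (by omega) (by omega)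
      (mem _ (by omega)) (mem _ (by omega)) (mem _ (by omega)) (mem _ (by omega))]
    have := hasDerivWithinAt_spline_three_right hab hn1 (mu3 a b n f)
    rw [right_sub_knot hn1, mu3_penultimate a b f hn1 rfl, mu3_last a b f hn1 rfl] at this
    rw [knot_of_ge hn1 (le_refl (n : ℤ))] at *
    refine this.congr_deriv ?_
    field_simp
    ring

end Cubic

end SplineQI

/-! ### The differentiation matrices -/

theorem mainTheorem7 (a b : ℝ) (hab : a < b) (f : ℝ → ℝ) (n : ℕ) :
    (4 ≤ n →
      (∀ i : Fin (n + 2),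
        HasDerivWithinAt (SplineQI.Q2 a b n f)
          ((SplineQI.D2 a b n).mulVec
            (fun k : Fin (n + 2) => f (SplineQI.tPoint a b n ((k : ℕ) + 1))) i)
          (Set.Icc a b) (SplineQI.tPoint a b n ((i : ℕ) + 1))) ∧
      (∀ j : ℤ, 4 ≤ j → j ≤ n - 1 →
        HasDerivAt (SplineQI.Q2 a b n f)
          ((1 / 16 * f (SplineQI.tPoint a b n (j - 2))
              - 5 / 8 * f (SplineQI.tPoint a b n (j - 1))
              + 0 * f (SplineQI.tPoint a b n j)
              + 5 / 8 * f (SplineQI.tPoint a b n (j + 1))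
              - 1 / 16 * f (SplineQI.tPoint a b n (j + 2))) / SplineQI.mesh a b n)
          (SplineQI.tPoint a b n j)) ∧
      (∀ i k : Fin (n + 2), 2 < |((i : ℕ) : ℤ) - ((k : ℕ) : ℤ)| → SplineQI.D2 a b n i k = 0)) ∧
    (3 ≤ n →
      (∀ i : Fin (n + 1),
        HasDerivWithinAt (SplineQI.Q3 a b n f)
          ((SplineQI.D3 a b n).mulVec
            (fun k : Fin (n + 1) => f (SplineQI.knot a b n (k : ℕ))) i)
          (Set.Icc a b) (SplineQI.knot a b n (i : ℕ))) ∧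
      (∀ j : ℤ, 2 ≤ j → j ≤ n - 2 →
        HasDerivAt (SplineQI.Q3 a b n f)
          ((1 / 12 * f (SplineQI.knot a b n (j - 2))
              - 2 / 3 * f (SplineQI.knot a b n (j - 1))
              + 0 * f (SplineQI.knot a b n j)
              + 2 / 3 * f (SplineQI.knot a b n (j + 1))
              - 1 / 12 * f (SplineQI.knot a b n (j + 2))) / SplineQI.mesh a b n)
          (SplineQI.knot a b n j)) ∧
      (∀ i k : Fin (n + 1), 3 < |((i : ℕ) : ℤ) - ((k : ℕ) : ℤ)| → SplineQI.D3 a b n i k = 0)) := by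
  refine ⟨fun hn => ⟨fun i => ?_, fun j => SplineQI.hasDerivAt_Q2_mid hab, SplineQI.D2_eq_zero a b⟩,
    fun hn => ⟨fun i => ?_, fun j => SplineQI.hasDerivAt_Q3_mid hab, SplineQI.D3_eq_zero a b⟩⟩
  · rw [SplineQI.D2_mulVec a b n (fun k => f (SplineQI.tPoint a b n k))]
    exact SplineQI.hasDerivWithinAt_Q2 hab hn (by omega) (by omega)
  · rw [SplineQI.D3_mulVec a b n (fun k => f (SplineQI.knot a b n k))]
    exact SplineQI.hasDerivWithinAt_Q3 hab hn (by omega) (by omega)
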